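/- Let $p(\cdot):\mathbb R^n\to(0,\infty)$ be measurable, and write $p_-=\operatorname{ess\,inf}p$, $p_+=\operatorname{ess\,sup}p$. For measurable $g$ put $$\|g\|_{p(\cdot)}=\inf\Big\{\lambda>0:\int_{\mathbb R^n}\Big(\frac{|g(x)|}{\lambda}\Big)^{p(x)}dx\le 1\Big\}\in[0,\infty],\qquad \inf\emptyset=\infty,$$ and let $L^{p(\cdot)}$ be the set of measurable $g$ with $\|g\|_{p(\cdot)}<\infty$. Let $Mf(x)=\sup_{Q\ni x}|Q|^{-1}\int_Q|f|$ be the Hardy–Littlewood maximal function, the supremum being over cubes with sides parallel to the axes. We say that $p(\cdot)\in M\mathcal P_0$ if $p_+<\infty$, $p_->0$ and there is a number $p_0$ with $0<p_0<p_-$ such that $M$ is bounded on $L^{p(\cdot)/p_0}$, i.e. $\|Mf\|_{p(\cdot)/p_0}\le C\|f\|_{p(\cdot)/p_0}$ for all $f\in L^{p(\cdot)/p_0}$, with $C$ independent of $f$. Let $\mathcal S$ be the space of Schwartz functions and $\mathcal S'$ the space of tempered distributions on $\mathbb R^n$. For $N\in\mathbb N$ let $\mathcal S_N$ be the set of $\Phi\in\mathcal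 S$ with $\sup_x|x^\alpha D^\beta\Phi(x)|\le 1$ for all multi-indices $|\alpha|,|\beta|\le N$. With $\Phi_t(x)=t^{-n}\Phi(x/t)$, define for $f\in\mathcal S'$ the grand maximal function $$\mathcal M_Nf(x)=\sup_{\Phi\in\mathcal S_N}\ \sup_{t>0}|f*\Phi_t(x)|.$$ Suppose $p(\cdot)\in M\mathcal P_0$, let $p_0$ be any number as in the definition of $M\mathcal P_0$, let $N>n/p_0+n+1$ be an integer, and set $$\|f\|_{H^{p(\cdot)}}=\|\mathcal M_Nf\|_{p(\cdot)},\qquad H^{p(\cdot)}=\{f\in\mathcal S':\|f\|_{H^{p(\cdot)}}<\infty\}.$$ Then: 1. $H^{p(\cdot)}$ is complete with respect to $\|\cdot\|_{H^{p(\cdot)}}$: if $f_k\in H^{p(\cdot)}$ and $\|f_j-f_k\|_{H^{p(\cdot)}}\to0$ as $j,k\to\infty$, then there is $g\in H^{p(\cdot)}$ with $\|f_k-g\|_{H^{p(\cdot)}}\to0$. 2. Convergence in $H^{p(\cdot)}$ implies convergence in $\mathcal S'$: if $f_k,g\in H^{p(\cdot)}$ and $\|f_k-g\|_{H^{p(\cdot)}}\to0$,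 then $\langle f_k,\Phi\rangle\to\langle g,\Phi\rangle$ for every $\Phi\in\mathcal S$. -/

import Mathlib

open MeasureTheory Filter Topology
open scoped ENNReal SchwartzMap LineDeriv

noncomputable section

namespace VariableHardy

/-- Euclidean space `ℝⁿ`, with Lebesgue measure `volume`. -/
abbrev Rn (n : ℕ) : Type := EuclideanSpace ℝ (Fin n)

/-! ### Variable Lebesgue spaces -/

/-- `p₋`, the essential infimum of a positive exponent function. -/
def expInf {n : ℕ} (p : Rn n → ℝ) : ℝ≥0∞ :=
  essInf (fun x => ENNReal.ofReal (p x)) volume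

/-- `p₊`, the essential supremum of a positive exponent function. -/
def expSup {n : ℕ} (p : Rn n → ℝ) : ℝ≥0∞ :=
  essSup (fun x => ENNReal.ofReal (p x)) volume

/-- The class `𝒫₀`: measurable exponents `p : ℝⁿ → (0, ∞)` with `p₊ < ∞`. -/
structure MemP0 {n : ℕ} (p : Rn n → ℝ) : Prop where
  measurable : Measurable p
  pos : ∀ x, 0 < p x
  expSup_lt_top : expSup p < ∞

/-- The modular `ρ(g) = ∫ g(x)^{p(x)} dx` of a `[0, ∞]`-valued function (the exponents are
finite everywhere). -/
def modular {n : ℕ} (p : Rn n → ℝ) (g : Rn n → ℝ≥0∞) : ℝ≥0∞ :=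
  ∫⁻ x, g x ^ p x

/-- The Luxemburg quasi-norm `inf {s > 0 : ρ(g / s) ≤ 1}` of a `[0, ∞]`-valued function;
it is `∞` if there is no such `s`. -/
def luxNorm {n : ℕ} (p : Rn n → ℝ) (g : Rn n → ℝ≥0∞) : ℝ≥0∞ :=
  ⨅ (s : ℝ) (_ : 0 < s) (_ : modular p (fun x => g x / ENNReal.ofReal s) ≤ 1), ENNReal.ofReal s

/-! ### The Hardy–Littlewood maximal operator -/

/-- The (open) cube with sides parallel to the axes, centre `c` and side length `2 r`. -/
def cube {n : ℕ} (c : Rn n) (r : ℝ) : Set (Rn n) := {y | ∀ i, |y i - c i| < r}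

/-- `Mf(x)`: the supremum of the averages of `|f|` over all cubes containing `x`. -/
def hlMax {n : ℕ} (f : Rn n → ℂ) (x : Rn n) : ℝ≥0∞ :=
  ⨆ (c : Rn n) (r : ℝ) (_ : 0 < r) (_ : x ∈ cube c r),
    (volume (cube c r))⁻¹ * ∫⁻ y in cube c r, ‖f y‖ₑ

/-- `0 < p₀ < p₋` and the maximal operator is bounded on `L^{p(·)/p₀}`. -/
def IsMaxExponent {n : ℕ} (p : Rn n → ℝ) (p₀ : ℝ) : Prop :=
  0 < p₀ ∧ ENNReal.ofReal p₀ < expInf p ∧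
    ∃ C : NNReal, ∀ f : Rn n → ℂ, AEStronglyMeasurable f volume →
      luxNorm (fun x => p x / p₀) (fun x => ‖f x‖ₑ) < ∞ →
      luxNorm (fun x => p x / p₀) (hlMax f)
        ≤ C * luxNorm (fun x => p x / p₀) (fun x => ‖f x‖ₑ)

/-- The class `M𝒫₀`. -/
def MemMP0 {n : ℕ} (p : Rn n → ℝ) : Prop :=
  MemP0 p ∧ 0 < expInf p ∧ ∃ p₀ : ℝ, IsMaxExponent p p₀

/-! ### The grand maximal operator on tempered distributions -/

/-- `D^β Φ = ∂₁^{β₁} ⋯ ∂ₙ^{βₙ} Φ`. -/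
def multiDeriv {n : ℕ} (β : Fin n → ℕ) (Φ : 𝓢(Rn n, ℂ)) : 𝓢(Rn n, ℂ) :=
  (List.finRange n).foldr
    (fun i (Ψ : 𝓢(Rn n, ℂ)) =>
      (fun Θ : 𝓢(Rn n, ℂ) => (∂_{(EuclideanSpace.single i 1 : Rn n)} Θ : 𝓢(Rn n, ℂ)))^[β i] Ψ) Φ

/-- `𝒮_N`: the Schwartz functions with `sup_x |x^α D^β Φ(x)| ≤ 1` for all multi-indices
`|α|, |β| ≤ N`. -/
def schwartzUnit (n N : ℕ) : Set 𝓢(Rn n, ℂ) :=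
  {Φ | ∀ α β : Fin n → ℕ, ∑ i, α i ≤ N → ∑ i, β i ≤ N →
    ∀ x : Rn n, |∏ i, x i ^ α i| * ‖multiDeriv β Φ x‖ ≤ 1}

lemma hasTemperateGrowth_reflDil {n : ℕ} (x : Rn n) (t : ℝ) :
    (fun y : Rn n => t⁻¹ • (x - y)).HasTemperateGrowth := by
  fun_prop

lemma antilipschitz_reflDil {n : ℕ} (x : Rn n) {t : ℝ} (ht : 0 < t) :
    AntilipschitzWith t.toNNReal (fun y : Rn n => t⁻¹ • (x - y)) := by
  refine AntilipschitzWith.of_le_mul_dist fun y z => ?_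
  rw [dist_smul₀, dist_sub_left, Real.norm_of_nonneg (inv_nonneg.2 ht.le),
    Real.coe_toNNReal _ ht.le, mul_inv_cancel_left₀ ht.ne']

/-- The Schwartz function `y ↦ Φ_t(x - y)`, where `Φ_t(z) = t^{-n} Φ(z / t)`. -/
def convTest {n : ℕ} (Φ : 𝓢(Rn n, ℂ)) {t : ℝ} (ht : 0 < t) (x : Rn n) : 𝓢(Rn n, ℂ) :=
  ((t : ℂ) ^ n)⁻¹ • SchwartzMap.compCLMOfAntilipschitz ℂ
    (hasTemperateGrowth_reflDil x t) (antilipschitz_reflDil x ht) Φ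

@[simp]
lemma convTest_apply {n : ℕ} (Φ : 𝓢(Rn n, ℂ)) {t : ℝ} (ht : 0 < t) (x y : Rn n) :
    convTest Φ ht x y = ((t : ℂ) ^ n)⁻¹ * Φ (t⁻¹ • (x - y)) := rfl

/-- The radial maximal function `M_{Φ,0} f(x) = sup_{t > 0} |f ∗ Φ_t(x)|`, where
`f ∗ Φ_t(x) = ⟨f, Φ_t(x - ·)⟩`. -/
def radialMax {n : ℕ} (Φ : 𝓢(Rn n, ℂ)) (f : 𝓢'(Rn n, ℂ)) (x : Rn n) : ℝ≥0∞ :=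
  ⨆ (t : ℝ) (ht : 0 < t), ‖f (convTest Φ ht x)‖ₑ

/-- The grand maximal function `ℳ_N f(x) = sup_{Φ ∈ 𝒮_N} M_{Φ,0} f(x)`. -/
def grandMax {n : ℕ} (N : ℕ) (f : 𝓢'(Rn n, ℂ)) (x : Rn n) : ℝ≥0∞ :=
  ⨆ Φ ∈ schwartzUnit n N, radialMax Φ f x

/-! ### Variable Hardy spaces -/

/-- `‖f‖_{H^{p(·)}} = ‖ℳ_N f‖_{p(·)}`. -/
def hardyNorm {n : ℕ} (N : ℕ) (p : Rn n → ℝ) (f : 𝓢'(Rn n, ℂ)) : ℝ≥0∞ :=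
  luxNorm p (grandMax N f)

/-- `H^{p(·)}`: the tempered distributions with `‖f‖_{H^{p(·)}} < ∞`. -/
def hardySpace {n : ℕ} (N : ℕ) (p : Rn n → ℝ) : Set 𝓢'(Rn n, ℂ) :=
  {f | hardyNorm N p f < ∞}

end VariableHardy

end

open MeasureTheory Filter Topology
open scoped ENNReal SchwartzMap LineDeriv

noncomputable section

namespace VariableHardy

variable {n : ℕ}

/-! ### Iterated derivatives of Schwartz functions -/

/-! Everything rests on one estimate: `‖f Φ‖ ≤ A * K * ‖f‖_H` whenever `A > 0` dominates `testSize N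
Φ`. For each `x` in the unit ball, `f Φ` is the value at `x` of `f ∗ Ψ` with `Ψ y = Φ (x - y)`, and
`A⁻¹ • Ψ` lies in `𝒮_N` with the same `A` for all these `x`. Hence `‖f Φ‖ / A` is a lower bound of
`ℳ_N f` on the whole ball (`enorm_apply_le_mul_grandMax`), and `exists_le_mul_luxNorm` turns this
into a bound by the quasi-norm.

Convergence in `𝒮'` is then immediate. For completeness, the estimate makes `f j Φ` a Cauchy
sequence of scalars; the limit functional differs from some `f J` by at most a multiple of the
continuous `testSize`, so it is a tempered distribution `g`. Lower semicontinuity of `ℳ_N` and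
Fatou's lemma give `‖f k - g‖_H ≤ ε` for large `k`, and a weak quasi-triangle inequality puts `g` in
the space. -/

lemma exists_clm_foldr_lineDeriv (β : Fin n → ℕ) (l : List (Fin n)) :
    ∃ L : 𝓢(Rn n, ℂ) →L[ℂ] 𝓢(Rn n, ℂ), ∀ Φ, L Φ = l.foldr
      (fun i (Ψ : 𝓢(Rn n, ℂ)) =>
        (fun Θ : 𝓢(Rn n, ℂ) =>
          (∂_{(EuclideanSpace.single i 1 : Rn n)} Θ : 𝓢(Rn n, ℂ)))^[β i] Ψ) Φ := by
  induction l with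
  | nil => exact ⟨ContinuousLinearMap.id ℂ _, fun _ => rfl⟩
  | cons i l ih =>
    obtain ⟨L, hL⟩ := ih
    refine ⟨((LineDeriv.lineDerivOpCLM ℂ 𝓢(Rn n, ℂ)
      (EuclideanSpace.single i 1 : Rn n)) ^ (β i)).comp L, fun Φ => ?_⟩
    rw [List.foldr_cons, ← hL, ContinuousLinearMap.comp_apply,
      FunLike.coe_pow_eq_iterate]
    rfl

lemma exists_clm_multiDeriv (β : Fin n → ℕ) :
    ∃ L : 𝓢(Rn n, ℂ) →L[ℂ] 𝓢(Rn n, ℂ), ∀ Φ, L Φ = multiDeriv β Φ :=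
  exists_clm_foldr_lineDeriv β _

lemma continuous_multiDeriv (β : Fin n → ℕ) : Continuous (multiDeriv β) := by
  obtain ⟨L, hL⟩ := exists_clm_multiDeriv β
  exact L.continuous.congr hL

lemma multiDeriv_smul (β : Fin n → ℕ) (c : ℂ) (Φ : 𝓢(Rn n, ℂ)) :
    multiDeriv β (c • Φ) = c • multiDeriv β Φ := by
  obtain ⟨L, hL⟩ := exists_clm_multiDeriv β
  rw [← hL, ← hL, map_smul]

lemma multiDeriv_zero (β : Fin n → ℕ) : multiDeriv β (0 : 𝓢(Rn n, ℂ)) = 0 := by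
  obtain ⟨L, hL⟩ := exists_clm_multiDeriv β
  rw [← hL, map_zero]

/-- The reflected translate `y ↦ Φ(x - y)`. -/
abbrev reflTranslate (x : Rn n) (Φ : 𝓢(Rn n, ℂ)) : 𝓢(Rn n, ℂ) := convTest Φ one_pos x

lemma reflTranslate_apply (x : Rn n) (Φ : 𝓢(Rn n, ℂ)) (y : Rn n) :
    reflTranslate x Φ y = Φ (x - y) := by
  simp [reflTranslate]

/-- This involution lets an arbitrary `Φ` appear as the test function of a convolution evaluated at
`x`. -/
lemma reflTranslate_reflTranslate (x : Rn n) (Φ : 𝓢(Rn n, ℂ)) :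
    reflTranslate x (reflTranslate x Φ) = Φ := by
  ext y
  simp only [reflTranslate_apply, sub_sub_cancel]

/-- The chain rule costs one sign per derivative; the scalar `c` is carried so that the formula
iterates. -/
lemma lineDeriv_smul_reflTranslate (x v : Rn n) (c : ℂ) (Φ : 𝓢(Rn n, ℂ)) :
    (∂_{v} (c • reflTranslate x Φ) : 𝓢(Rn n, ℂ)) =
      (-c) • reflTranslate x (∂_{v} Φ : 𝓢(Rn n, ℂ)) := by
  ext y
  rw [LineDeriv.lineDerivOp_smul]
  have h : HasFDerivAt (fun z => Φ (x - z))
      ((fderiv ℝ Φ (x - y)).comp (-ContinuousLinearMap.id ℝ (Rn n))) y :=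
    (Φ.differentiableAt (x := x - y)).hasFDerivAt.comp y ((hasFDerivAt_id y).const_sub x)
  have h' : (∂_{v} (reflTranslate x Φ) : 𝓢(Rn n, ℂ)) y = -(∂_{v} Φ : 𝓢(Rn n, ℂ)) (x - y) := by
    rw [SchwartzMap.lineDerivOp_apply_eq_fderiv, SchwartzMap.lineDerivOp_apply_eq_fderiv,
      show (reflTranslate x Φ : Rn n → ℂ) = fun z => Φ (x - z) from
        funext (reflTranslate_apply x Φ), h.fderiv]
    simp
  rw [smul_apply, smul_apply, h', reflTranslate_apply]
  simp

lemma exists_foldr_lineDeriv_reflTranslate (β : Fin n → ℕ) (x : Rn n) (Φ : 𝓢(Rn n, ℂ))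
    (l : List (Fin n)) :
    ∃ c : ℂ, ‖c‖ = 1 ∧ l.foldr
      (fun i (Ψ : 𝓢(Rn n, ℂ)) =>
        (fun Θ : 𝓢(Rn n, ℂ) =>
          (∂_{(EuclideanSpace.single i 1 : Rn n)} Θ : 𝓢(Rn n, ℂ)))^[β i] Ψ) (reflTranslate x Φ)
      = c • reflTranslate x (l.foldr
      (fun i (Ψ : 𝓢(Rn n, ℂ)) =>
        (fun Θ : 𝓢(Rn n, ℂ) =>
          (∂_{(EuclideanSpace.single i 1 : Rn n)} Θ : 𝓢(Rn n, ℂ)))^[β i] Ψ) Φ) := by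
  induction l with
  | nil => exact ⟨1, by simp, by simp⟩
  | cons i l ih =>
    rw [List.foldr_cons, List.foldr_cons]
    induction β i with
    | zero => exact ih
    | succ k ihk =>
      obtain ⟨c, hc, h⟩ := ihk
      refine ⟨-c, by simpa using hc, ?_⟩
      rw [Function.iterate_succ_apply', Function.iterate_succ_apply', h,
        lineDeriv_smul_reflTranslate]

lemma norm_multiDeriv_reflTranslate (β : Fin n → ℕ) (x y : Rn n) (Φ : 𝓢(Rn n, ℂ)) :
    ‖multiDeriv β (reflTranslate x Φ) y‖ = ‖multiDeriv β Φ (x - y)‖ := by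
  obtain ⟨c, hc, h⟩ := exists_foldr_lineDeriv_reflTranslate β x Φ (List.finRange n)
  rw [multiDeriv, h, smul_apply, reflTranslate_apply, norm_smul, hc, one_mul]
  rfl

/-! ### Uniform control of the reflected translates -/

/-- A continuous function on `𝓢` that dominates the norms defining `𝒮_N` for all translates of a
Schwartz function by vectors of the unit ball. -/
def testSize (N : ℕ) (Φ : 𝓢(Rn n, ℂ)) : ℝ :=
  ∑ β : Fin n → Fin (N + 1), 4 ^ N *
    ((Finset.Iic ((N, 0) : ℕ × ℕ)).sup fun m => SchwartzMap.seminorm ℝ m.1 m.2)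
      (multiDeriv (fun i => (β i : ℕ)) Φ)

lemma continuous_testSize (N : ℕ) : Continuous (testSize N : 𝓢(Rn n, ℂ) → ℝ) := by
  refine continuous_finsetSum _ fun β _ => continuous_const.mul ?_
  have h : Continuous (⇑((Finset.Iic ((N, 0) : ℕ × ℕ)).sup
      fun m => SchwartzMap.seminorm ℝ m.1 m.2 : Seminorm ℝ 𝓢(Rn n, ℂ))) :=
    Seminorm.continuous_finsetSup fun i _ =>
      (schwartz_withSeminorms ℝ (Rn n) ℂ).continuous_seminorm i
  exact h.comp (continuous_multiDeriv _)

lemma testSize_zero (N : ℕ) : testSize N (0 : 𝓢(Rn n, ℂ)) = 0 := by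
  simp [testSize, multiDeriv_zero]

lemma testSize_nonneg (N : ℕ) (Φ : 𝓢(Rn n, ℂ)) : 0 ≤ testSize N Φ :=
  Finset.sum_nonneg fun _ _ => by positivity

lemma abs_prod_pow_le (α : Fin n → ℕ) (y : Rn n) :
    |∏ i, y i ^ α i| ≤ (1 + ‖y‖) ^ ∑ i, α i := by
  rw [Finset.abs_prod, ← Finset.prod_pow_eq_pow_sum]
  refine Finset.prod_le_prod (fun _ _ => abs_nonneg _) fun i _ => ?_
  rw [abs_pow]
  have := PiLp.norm_apply_le y i
  rw [Real.norm_eq_abs] at this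
  gcongr
  linarith

lemma prod_pow_mul_multiDeriv_reflTranslate_le (N : ℕ) (Φ : 𝓢(Rn n, ℂ)) {x : Rn n}
    (hx : ‖x‖ ≤ 1) (α β : Fin n → ℕ) (hα : ∑ i, α i ≤ N) (hβ : ∑ i, β i ≤ N) (y : Rn n) :
    |∏ i, y i ^ α i| * ‖multiDeriv β (reflTranslate x Φ) y‖ ≤ testSize N Φ := by
  rw [norm_multiDeriv_reflTranslate]
  -- Since `‖x‖ ≤ 1`, weights at `y` and `x - y` are comparable. This costs one factor `2 ^ N`; the
  -- seminorm bound `h2` costs the other, whence `4 ^ N`.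
  have hy : 1 + ‖y‖ ≤ 2 * (1 + ‖x - y‖) := by
    have := norm_sub_le x (x - y)
    rw [sub_sub_cancel] at this
    linarith [norm_nonneg (x - y)]
  have h1 : |∏ i, y i ^ α i| ≤ 2 ^ N * (1 + ‖x - y‖) ^ N := by
    calc |∏ i, y i ^ α i| ≤ (1 + ‖y‖) ^ ∑ i, α i := abs_prod_pow_le α y
      _ ≤ (1 + ‖y‖) ^ N := pow_le_pow_right₀ (by linarith [norm_nonneg y]) hα
      _ ≤ (2 * (1 + ‖x - y‖)) ^ N := by gcongr
      _ = _ := mul_pow _ _ _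
  have h2 := SchwartzMap.one_add_le_sup_seminorm_apply (𝕜 := ℝ) (m := (N, 0)) (k := N) (n := 0)
    le_rfl le_rfl (multiDeriv β Φ) (x - y)
  rw [norm_iteratedFDeriv_zero] at h2
  -- Every `β` with `|β| ≤ N` is thus an index of the sum defining `testSize`.
  have hβ' : ∀ i, β i < N + 1 := fun i =>
    Nat.lt_succ_of_le ((Finset.single_le_sum (fun _ _ => Nat.zero_le _) (Finset.mem_univ i)).trans
      hβ)
  calc |∏ i, y i ^ α i| * ‖multiDeriv β Φ (x - y)‖
      ≤ (2 ^ N * (1 + ‖x - y‖) ^ N) * ‖multiDeriv β Φ (x - y)‖ := by gcongr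
    _ = 2 ^ N * ((1 + ‖x - y‖) ^ N * ‖multiDeriv β Φ (x - y)‖) := by ring
    _ ≤ 2 ^ N * (2 ^ N * ((Finset.Iic ((N, 0) : ℕ × ℕ)).sup
          fun m => SchwartzMap.seminorm ℝ m.1 m.2) (multiDeriv β Φ)) := by gcongr
    _ = 4 ^ N * ((Finset.Iic ((N, 0) : ℕ × ℕ)).sup
          fun m => SchwartzMap.seminorm ℝ m.1 m.2) (multiDeriv β Φ) := by
        rw [← mul_assoc, ← mul_pow]; norm_num
    _ ≤ testSize N Φ := Finset.single_le_sum (f := fun β : Fin n → Fin (N + 1) => 4 ^ N *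
          ((Finset.Iic ((N, 0) : ℕ × ℕ)).sup fun m => SchwartzMap.seminorm ℝ m.1 m.2)
            (multiDeriv (fun i => (β i : ℕ)) Φ)) (fun _ _ => by positivity)
          (Finset.mem_univ fun i => ⟨β i, hβ' i⟩)

lemma enorm_apply_convTest_le_grandMax {N : ℕ} (f : 𝓢'(Rn n, ℂ)) {Φ : 𝓢(Rn n, ℂ)}
    (hΦ : Φ ∈ schwartzUnit n N) {t : ℝ} (ht : 0 < t) (x : Rn n) :
    ‖f (convTest Φ ht x)‖ₑ ≤ grandMax N f x :=
  (le_iSup₂ (f := fun (t : ℝ) (ht : 0 < t) => ‖f (convTest Φ ht x)‖ₑ) t ht).trans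
    (le_iSup₂ (f := fun (Φ : 𝓢(Rn n, ℂ)) (_ : Φ ∈ schwartzUnit n N) => radialMax Φ f x) Φ hΦ)

/-- The grand maximal function controls a tempered distribution uniformly on the unit ball. -/
lemma enorm_apply_le_mul_grandMax (N : ℕ) (f : 𝓢'(Rn n, ℂ)) (Φ : 𝓢(Rn n, ℂ)) {A : ℝ}
    (hA : 0 < A) (hΦ : testSize N Φ ≤ A) {x : Rn n} (hx : ‖x‖ ≤ 1) :
    ‖f Φ‖ₑ ≤ ENNReal.ofReal A * grandMax N f x := by
  have hmem : ((A : ℂ)⁻¹ • reflTranslate x Φ) ∈ schwartzUnit n N := by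
    intro α β hα hβ y
    have h := (prod_pow_mul_multiDeriv_reflTranslate_le N Φ hx α β hα hβ y).trans hΦ
    rw [multiDeriv_smul, smul_apply, norm_smul, norm_inv, Complex.norm_real,
      Real.norm_of_nonneg hA.le, mul_left_comm]
    exact (inv_mul_le_one₀ hA).2 h
  have hΦ' : Φ = (A : ℂ) • convTest ((A : ℂ)⁻¹ • reflTranslate x Φ) one_pos x := by
    conv_lhs => rw [← reflTranslate_reflTranslate x Φ]
    have : convTest ((A : ℂ)⁻¹ • reflTranslate x Φ) one_pos x =
        (A : ℂ)⁻¹ • reflTranslate x (reflTranslate x Φ) := by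
      ext y
      simp only [smul_apply, reflTranslate, convTest_apply, smul_eq_mul]
      ring
    rw [this, smul_inv_smul₀ (by exact_mod_cast hA.ne')]
  calc ‖f Φ‖ₑ = ‖(A : ℂ)‖ₑ * ‖f (convTest ((A : ℂ)⁻¹ • reflTranslate x Φ) one_pos x)‖ₑ := by
        conv_lhs => rw [hΦ', map_smul, enorm_smul]
    _ = ENNReal.ofReal A * ‖f (convTest ((A : ℂ)⁻¹ • reflTranslate x Φ) one_pos x)‖ₑ := by
        rw [← ofReal_norm, Complex.norm_real, Real.norm_of_nonneg hA.le]
    _ ≤ _ := by gcongr; exact enorm_apply_convTest_le_grandMax f hmem one_pos x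

/-! ### Continuity of translations and measurability of the grand maximal function -/

/-- Mean value inequality on the ball of radius `‖h‖ ≤ 1` about `y`, where the weight `1 + ‖z‖` is
at least half of `1 + ‖y‖`. -/
lemma norm_iteratedFDeriv_sub_le (k l : ℕ) (Φ : 𝓢(Rn n, ℂ)) {h : Rn n} (hh : ‖h‖ ≤ 1)
    (y : Rn n) :
    ‖y‖ ^ k * ‖iteratedFDeriv ℝ l Φ (y - h) - iteratedFDeriv ℝ l Φ y‖ ≤
      2 ^ k * (2 ^ k * ((Finset.Iic ((k, l + 1) : ℕ × ℕ)).sup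
        fun m => SchwartzMap.seminorm ℝ m.1 m.2) Φ) * ‖h‖ := by
  set S := ((Finset.Iic ((k, l + 1) : ℕ × ℕ)).sup fun m => SchwartzMap.seminorm ℝ m.1 m.2) Φ
  have hdiff : Differentiable ℝ (iteratedFDeriv ℝ l Φ) :=
    (Φ.smooth ⊤).differentiable_iteratedFDeriv (mod_cast ENat.natCast_lt_top l)
  have hbound : ∀ z ∈ Metric.closedBall y ‖h‖, ‖fderiv ℝ (iteratedFDeriv ℝ l Φ) z‖ ≤
      2 ^ k * (2 ^ k * S) / (1 + ‖y‖) ^ k := by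
    intro z hz
    rw [norm_fderiv_iteratedFDeriv, le_div_iff₀ (by positivity)]
    have hz' : 1 + ‖y‖ ≤ 2 * (1 + ‖z‖) := by
      rw [mem_closedBall_iff_norm'] at hz
      have := norm_le_norm_add_norm_sub' y z
      linarith [norm_nonneg z]
    have h2 := SchwartzMap.one_add_le_sup_seminorm_apply (𝕜 := ℝ) (m := (k, l + 1)) (k := k)
      (n := l + 1) le_rfl le_rfl Φ z
    calc ‖iteratedFDeriv ℝ (l + 1) Φ z‖ * (1 + ‖y‖) ^ k
        ≤ ‖iteratedFDeriv ℝ (l + 1) Φ z‖ * (2 * (1 + ‖z‖)) ^ k := by gcongr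
      _ = 2 ^ k * ((1 + ‖z‖) ^ k * ‖iteratedFDeriv ℝ (l + 1) Φ z‖) := by rw [mul_pow]; ring
      _ ≤ _ := by gcongr
  have hmv := Convex.norm_image_sub_le_of_norm_fderiv_le (fun z _ => hdiff z) hbound
    (convex_closedBall y ‖h‖) (Metric.mem_closedBall_self (norm_nonneg h))
    (show y - h ∈ Metric.closedBall y ‖h‖ by simp)
  rw [show y - h - y = -h by abel, norm_neg] at hmv
  have hS : 0 ≤ S := apply_nonneg _ _
  calc ‖y‖ ^ k * ‖iteratedFDeriv ℝ l Φ (y - h) - iteratedFDeriv ℝ l Φ y‖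
      ≤ (1 + ‖y‖) ^ k * (2 ^ k * (2 ^ k * S) / (1 + ‖y‖) ^ k * ‖h‖) := by
        gcongr
        linarith
    _ = _ := by
        have : (1 + ‖y‖) ^ k ≠ 0 := by positivity
        field_simp

lemma tendsto_compSubConstCLM_zero (Φ : 𝓢(Rn n, ℂ)) :
    Tendsto (fun h : Rn n => Φ.compSubConstCLM ℂ h) (𝓝 0) (𝓝 Φ) := by
  rw [(schwartz_withSeminorms ℝ (Rn n) ℂ).tendsto_nhds]
  rintro ⟨k, l⟩ ε hε
  set C := 2 ^ k * (2 ^ k * ((Finset.Iic ((k, l + 1) : ℕ × ℕ)).sup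
        fun m => SchwartzMap.seminorm ℝ m.1 m.2) Φ)
  have hC : Tendsto (fun h : Rn n => C * ‖h‖) (𝓝 0) (𝓝 0) := by
    have : Continuous fun h : Rn n => C * ‖h‖ := by fun_prop
    simpa using this.tendsto 0
  filter_upwards [hC.eventually_lt_const hε, Metric.closedBall_mem_nhds (0 : Rn n) one_pos]
    with h hh h1
  rw [mem_closedBall_zero_iff] at h1
  refine lt_of_le_of_lt ?_ hh
  refine SchwartzMap.seminorm_le_bound ℝ k l _ (by positivity) fun y => ?_
  have : iteratedFDeriv ℝ l (Φ.compSubConstCLM ℂ h - Φ : 𝓢(Rn n, ℂ)) y =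
      iteratedFDeriv ℝ l Φ (y - h) - iteratedFDeriv ℝ l Φ y := by
    rw [← iteratedFDeriv_comp_sub l h y]
    exact iteratedFDeriv_sub_apply ((Φ.compSubConstCLM ℂ h).smooth l).contDiffAt
      (Φ.smooth l).contDiffAt
  rw [this]
  exact norm_iteratedFDeriv_sub_le k l Φ h1 y

lemma continuous_compSubConstCLM (Φ : 𝓢(Rn n, ℂ)) :
    Continuous fun a : Rn n => Φ.compSubConstCLM ℂ a := by
  refine continuous_iff_continuousAt.2 fun a => ?_
  -- By the group law, translation by `b` is translation by `b - a` after translation by `a`, so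
  -- continuity at zero suffices.
  have h := (tendsto_compSubConstCLM_zero (Φ.compSubConstCLM ℂ a)).comp
    (show Tendsto (fun b => b - a) (𝓝 a) (𝓝 0) by
      simpa using (continuous_sub_right a).tendsto a)
  refine h.congr fun b => ?_
  simp

lemma continuous_convTest (Φ : 𝓢(Rn n, ℂ)) {t : ℝ} (ht : 0 < t) :
    Continuous fun x : Rn n => convTest Φ ht x := by
  refine (continuous_compSubConstCLM (convTest Φ ht 0)).congr fun x => ?_
  ext y
  simp

/-- Each `x ↦ ‖f ∗ Φ_t(x)‖` is continuous, and even an uncountable supremum of such functions is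
lower semicontinuous. -/
lemma measurable_grandMax (N : ℕ) (f : 𝓢'(Rn n, ℂ)) : Measurable (grandMax N f) := by
  refine LowerSemicontinuous.measurable ?_
  refine lowerSemicontinuous_iSup fun Φ => lowerSemicontinuous_iSup fun _ =>
    lowerSemicontinuous_iSup fun t => lowerSemicontinuous_iSup fun ht => ?_
  exact (f.continuous.comp (continuous_convTest Φ ht)).enorm.lowerSemicontinuous

lemma grandMax_sub_le (N : ℕ) (f g : 𝓢'(Rn n, ℂ)) (x : Rn n) :
    grandMax N (f - g) x ≤ grandMax N f x + grandMax N g x := by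
  refine iSup₂_le fun Φ hΦ => iSup₂_le fun t ht => ?_
  calc ‖f (convTest Φ ht x) - g (convTest Φ ht x)‖ₑ
      ≤ ‖f (convTest Φ ht x)‖ₑ + ‖g (convTest Φ ht x)‖ₑ := enorm_sub_le
    _ ≤ _ := add_le_add (enorm_apply_convTest_le_grandMax f hΦ ht x)
      (enorm_apply_convTest_le_grandMax g hΦ ht x)

/-- The grand maximal function is lower semicontinuous under pointwise convergence. -/
lemma grandMax_le_liminf (N : ℕ) {f : ℕ → 𝓢'(Rn n, ℂ)} {g : 𝓢'(Rn n, ℂ)}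
    (h : ∀ Φ, Tendsto (fun j => f j Φ) atTop (𝓝 (g Φ))) (x : Rn n) :
    grandMax N g x ≤ liminf (fun j => grandMax N (f j) x) atTop := by
  refine iSup₂_le fun Φ hΦ => iSup₂_le fun t ht => ?_
  rw [← (h (convTest Φ ht x)).enorm.liminf_eq]
  exact liminf_le_liminf (Eventually.of_forall fun j =>
    enorm_apply_convTest_le_grandMax (f j) hΦ ht x)

/-! ### The Luxemburg quasi-norm -/

lemma luxNorm_le_of_modular_le {p : Rn n → ℝ} {g : Rn n → ℝ≥0∞} {s : ℝ} (hs : 0 < s)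
    (h : modular p (fun x => g x / ENNReal.ofReal s) ≤ 1) : luxNorm p g ≤ ENNReal.ofReal s :=
  iInf_le_of_le s (iInf_le_of_le hs (iInf_le _ h))

lemma modular_mono {p : Rn n → ℝ} (hp : ∀ x, 0 < p x) {g h : Rn n → ℝ≥0∞}
    (hgh : ∀ x, g x ≤ h x) : modular p g ≤ modular p h :=
  lintegral_mono fun x => ENNReal.rpow_le_rpow (hgh x) (hp x).le

lemma modular_le_one_of_luxNorm_lt {p : Rn n → ℝ} (hp : ∀ x, 0 < p x) {g : Rn n → ℝ≥0∞} {s : ℝ}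
    (h : luxNorm p g < ENNReal.ofReal s) :
    modular p (fun x => g x / ENNReal.ofReal s) ≤ 1 := by
  simp only [luxNorm, iInf_lt_iff] at h
  obtain ⟨r, hr, hmod, hrs⟩ := h
  exact (modular_mono hp fun x => by gcongr).trans hmod

lemma exists_modular_le_one {p : Rn n → ℝ} (hp : ∀ x, 0 < p x) {g : Rn n → ℝ≥0∞}
    (h : luxNorm p g < ∞) :
    ∃ s₀ : ℝ, 0 < s₀ ∧ ∀ s ≥ s₀, modular p (fun x => g x / ENNReal.ofReal s) ≤ 1 := by
  refine ⟨(luxNorm p g).toReal + 1, by positivity, fun s hs => modular_le_one_of_luxNorm_lt hp ?_⟩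
  refine (ENNReal.lt_ofReal_iff_toReal_lt h.ne).2 (by linarith)

lemma ae_lt_of_isMaxExponent {p : Rn n → ℝ} {p₀ : ℝ} (h : IsMaxExponent p p₀) :
    ∀ᵐ x, p₀ < p x := by
  filter_upwards [ae_lt_of_lt_essInf h.2.1] with x hx
  exact (ENNReal.ofReal_lt_ofReal_iff').1 hx |>.1

/-- A function bounded below on the unit ball has a large Luxemburg quasi-norm. -/
lemma exists_le_mul_luxNorm {p : Rn n → ℝ} {p₀ : ℝ} (h₀ : IsMaxExponent p p₀) :
    ∃ K : ℝ≥0∞, K ≠ ∞ ∧ ∀ (g : Rn n → ℝ≥0∞) (c : ℝ≥0∞), (∀ x, ‖x‖ ≤ 1 → c ≤ g x) →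
      c ≤ K * luxNorm p g := by
  set V := volume (Metric.closedBall (0 : Rn n) 1)
  have hV : V ≠ 0 := (Metric.measure_closedBall_pos volume _ one_pos).ne'
  have hp₀ := h₀.1
  set K : ℝ≥0∞ := max 1 (V⁻¹ ^ p₀⁻¹)
  have hK0 : K ≠ 0 := (zero_lt_one.trans_le (le_max_left _ _)).ne'
  have hK : K ≠ ∞ := by
    simp only [K, ne_eq, max_eq_top, ENNReal.one_ne_top, false_or]
    exact ENNReal.rpow_ne_top_of_nonneg (inv_nonneg.2 hp₀.le) (ENNReal.inv_ne_top.2 hV)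
  -- For `b ≥ 1`, `p > p₀` a.e. gives `b ^ p₀ * V ≤ ∫ b ^ p ≤ 1`; the `1` in `K` covers `b ≤ 1`.
  have key : ∀ b : ℝ≥0∞, ∫⁻ x in Metric.closedBall (0 : Rn n) 1, b ^ p x ≤ 1 → b ≤ K := by
    intro b hb
    rcases le_total b 1 with h1 | h1
    · exact h1.trans (le_max_left _ _)
    · refine le_max_of_le_right ?_
      have : b ^ p₀ * V ≤ 1 := by
        rw [← setLIntegral_const]
        refine le_trans (lintegral_mono_ae ?_) hb
        filter_upwards [ae_restrict_of_ae (ae_lt_of_isMaxExponent h₀)] with x hx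
        exact ENNReal.rpow_le_rpow_of_exponent_le h1 hx.le
      rw [ENNReal.le_rpow_inv_iff hp₀]
      exact ENNReal.le_inv_iff_mul_le.2 this
  refine ⟨K, hK, fun g c hc => ?_⟩
  rw [mul_comm, ← ENNReal.div_le_iff hK0 hK]
  refine le_iInf fun s => le_iInf fun hs => le_iInf fun hmod => ?_
  have hs0 : ENNReal.ofReal s ≠ 0 := by simpa using hs
  rw [ENNReal.div_le_iff hK0 hK, mul_comm, ← ENNReal.div_le_iff hs0 ENNReal.ofReal_ne_top]
  refine key _ (le_trans ?_ hmod)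
  calc ∫⁻ x in Metric.closedBall (0 : Rn n) 1, (c / ENNReal.ofReal s) ^ p x
      ≤ ∫⁻ x in Metric.closedBall (0 : Rn n) 1, (g x / ENNReal.ofReal s) ^ p x := by
        refine lintegral_mono_ae ?_
        filter_upwards [ae_restrict_of_ae (ae_lt_of_isMaxExponent h₀),
          ae_restrict_mem Metric.isClosed_closedBall.measurableSet] with x hx hxB
        have := hc x (by simpa using hxB)
        have : 0 ≤ p x := (hp₀.trans hx).le
        gcongr
    _ ≤ _ := setLIntegral_le_lintegral _ _

/-- Exponents below one rule out convexity. Instead `u ≤ 2 * max v w`, and an extra factor `θ` in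
the normalisation halves the modulars, because `θ ^ p x ≤ θ ^ p₀ = 1/2` for a.e. `x`. -/
lemma luxNorm_lt_top_of_le_add {p : Rn n → ℝ} (hp : MemP0 p) {p₀ : ℝ} (h₀ : IsMaxExponent p p₀)
    {u v w : Rn n → ℝ≥0∞} (hv : Measurable v) (huvw : ∀ x, u x ≤ v x + w x)
    (hvf : luxNorm p v < ∞) (hwf : luxNorm p w < ∞) : luxNorm p u < ∞ := by
  obtain ⟨s₁, hs₁, h₁⟩ := exists_modular_le_one hp.pos hvf
  obtain ⟨s₂, hs₂, h₂⟩ := exists_modular_le_one hp.pos hwf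
  set s := max s₁ s₂
  have hs : 0 < s := lt_max_of_lt_left hs₁
  set S := ENNReal.ofReal s
  have hp₀ := h₀.1
  set θ : ℝ≥0∞ := 2⁻¹ ^ p₀⁻¹ with hθ
  have hθp : θ ^ p₀ = 2⁻¹ := ENNReal.rpow_inv_rpow hp₀.ne' _
  have hθ1 : θ ≤ 1 := ENNReal.rpow_le_one (by simp) (inv_nonneg.2 hp₀.le)
  have hθ0 : θ ≠ 0 := by simp [hθ, ENNReal.rpow_eq_zero_iff]
  have hθt : θ ≠ ∞ := (hθ1.trans_lt ENNReal.one_lt_top).ne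
  have hS0 : S ≠ 0 := by simpa [S] using hs
  have hSt : S ≠ ∞ := ENNReal.ofReal_ne_top
  set T : ℝ≥0∞ := 2 * S / θ with hT
  have hTt : T ≠ ∞ := ENNReal.div_ne_top (ENNReal.mul_ne_top (by simp) hSt) hθ0
  have hT0 : T ≠ 0 := by simp [hT, hS0, hθt]
  have hTs : ENNReal.ofReal T.toReal = T := ENNReal.ofReal_toReal hTt
  refine (luxNorm_le_of_modular_le (ENNReal.toReal_pos hT0 hTt) ?_).trans_lt
    ENNReal.ofReal_lt_top
  rw [hTs]
  have hpt : ∀ x, u x / T ≤ θ * max (v x / S) (w x / S) := by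
    intro x
    rw [ENNReal.div_le_iff hT0 hTt]
    have h2 : θ * max (v x / S) (w x / S) * T = 2 * max (v x) (w x) := by
      have : max (v x / S) (w x / S) = max (v x) (w x) / S :=
        (Monotone.map_max (f := fun a : ℝ≥0∞ => a / S)
          (fun a b hab => ENNReal.div_le_div_right hab S)).symm
      rw [this, hT]
      calc θ * (max (v x) (w x) / S) * (2 * S / θ)
          = 2 * (max (v x) (w x) / S * S) * (θ / θ) := by
            simp only [div_eq_mul_inv]; ring
        _ = _ := by rw [ENNReal.div_mul_cancel hS0 hSt, ENNReal.div_self hθ0 hθt, mul_one]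
    rw [h2, two_mul]
    exact (huvw x).trans (add_le_add (le_max_left _ _) (le_max_right _ _))
  calc modular p (fun x => u x / T)
      ≤ ∫⁻ x, 2⁻¹ * ((v x / S) ^ p x + (w x / S) ^ p x) := by
        refine lintegral_mono_ae ?_
        filter_upwards [ae_lt_of_isMaxExponent h₀] with x hx
        have hpx := (hp.pos x).le
        calc (u x / T) ^ p x ≤ (θ * max (v x / S) (w x / S)) ^ p x := by
              gcongr; exact hpt x
          _ = θ ^ p x * max (v x / S) (w x / S) ^ p x := ENNReal.mul_rpow_of_nonneg _ _ hpx
          _ ≤ θ ^ p₀ * ((v x / S) ^ p x + (w x / S) ^ p x) := by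
              refine mul_le_mul' (ENNReal.rpow_le_rpow_of_exponent_ge hθ1 hx.le) ?_
              rcases max_choice (v x / S) (w x / S) with h | h <;> rw [h]
              · exact le_self_add
              · exact le_add_self
          _ = _ := by rw [hθp]
    _ = 2⁻¹ * (modular p (fun x => v x / S) + modular p (fun x => w x / S)) := by
        rw [lintegral_const_mul' _ _ (by simp), lintegral_add_left]
        · rfl
        · exact (hv.div_const S).pow hp.measurable
    _ ≤ 2⁻¹ * (1 + 1) := by
        gcongr
        · exact h₁ s (le_max_left _ _)
        · exact h₂ s (le_max_right _ _)
    _ = 1 := by rw [one_add_one_eq_two]; exact ENNReal.inv_mul_cancel (by simp) (by simp)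

/-- Fatou's lemma for the Luxemburg quasi-norm. -/
lemma luxNorm_le_of_le_liminf {p : Rn n → ℝ} (hp : MemP0 p) {G : ℕ → Rn n → ℝ≥0∞}
    (hG : ∀ j, Measurable (G j)) {g : Rn n → ℝ≥0∞}
    (hg : ∀ x, g x ≤ liminf (fun j => G j x) atTop) {ε : ℝ} (hε : 0 < ε)
    (h : ∀ᶠ j in atTop, luxNorm p (G j) < ENNReal.ofReal ε) : luxNorm p g ≤ ENNReal.ofReal ε := by
  refine luxNorm_le_of_modular_le hε ?_
  set E := ENNReal.ofReal ε
  have hE : E ≠ 0 := by simpa [E] using hε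
  calc modular p (fun x => g x / E)
      ≤ ∫⁻ x, liminf (fun j => (G j x / E) ^ p x) atTop := by
        refine lintegral_mono fun x => ?_
        have hpx := (hp.pos x).le
        -- A monotone continuous map commutes with the liminf.
        have hmono : Monotone fun a : ℝ≥0∞ => (a / E) ^ p x := fun a b hab => by
          dsimp only; gcongr
        have hcont : Continuous fun a : ℝ≥0∞ => (a / E) ^ p x :=
          ENNReal.continuous_rpow_const.comp (ENNReal.continuous_div_const E hE)
        refine (hmono (hg x)).trans_eq ?_
        exact hmono.map_liminf_of_continuousAt _ hcont.continuousAt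
    _ ≤ liminf (fun j => ∫⁻ x, (G j x / E) ^ p x) atTop :=
        lintegral_liminf_le fun j => ((hG j).div_const E).pow hp.measurable
    _ ≤ 1 := by
        refine (liminf_le_liminf (v := fun _ => (1 : ℝ≥0∞)) ?_).trans_eq (liminf_const 1)
        filter_upwards [h] with j hj
        exact modular_le_one_of_luxNorm_lt hp.pos hj

/-! ### The Hardy quasi-norm and tempered distributions -/

/-- The Hardy quasi-norm controls every tempered distribution by a fixed continuous function on
the Schwartz space. -/
lemma exists_enorm_apply_le_mul_hardyNorm {p : Rn n → ℝ} {p₀ : ℝ} (h₀ : IsMaxExponent p p₀)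
    (N : ℕ) : ∃ K : ℝ≥0∞, K ≠ ∞ ∧ ∀ (f : 𝓢'(Rn n, ℂ)) (Φ : 𝓢(Rn n, ℂ)) (A : ℝ), 0 < A →
      testSize N Φ ≤ A → ‖f Φ‖ₑ ≤ ENNReal.ofReal A * K * hardyNorm N p f := by
  obtain ⟨K, hK, h⟩ := exists_le_mul_luxNorm h₀
  refine ⟨K, hK, fun f Φ A hA hΦ => ?_⟩
  have hA0 : ENNReal.ofReal A ≠ 0 := by simpa using hA
  have := h (grandMax N f) (‖f Φ‖ₑ / ENNReal.ofReal A) fun x hx => by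
    rw [ENNReal.div_le_iff hA0 ENNReal.ofReal_ne_top, mul_comm]
    exact enorm_apply_le_mul_grandMax N f Φ hA hΦ hx
  rw [ENNReal.div_le_iff hA0 ENNReal.ofReal_ne_top] at this
  calc ‖f Φ‖ₑ ≤ K * luxNorm p (grandMax N f) * ENNReal.ofReal A := this
    _ = _ := by rw [hardyNorm]; ring

/-- Convergence in the Hardy space implies pointwise convergence of tempered distributions. -/
lemma tendsto_of_tendsto_hardyNorm {p : Rn n → ℝ} {p₀ : ℝ} (h₀ : IsMaxExponent p p₀) (N : ℕ)
    {f : ℕ → 𝓢'(Rn n, ℂ)} {g : 𝓢'(Rn n, ℂ)}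
    (h : Tendsto (fun k => hardyNorm N p (f k - g)) atTop (𝓝 0)) : Tendsto f atTop (𝓝 g) := by
  obtain ⟨K, hK, hle⟩ := exists_enorm_apply_le_mul_hardyNorm h₀ N
  refine PointwiseConvergenceCLM.tendsto_iff_forall_tendsto.2 fun Φ => ?_
  -- The `+ 1` keeps `A` positive when `testSize` vanishes.
  set A := testSize N Φ + 1
  have hA : 0 < A := by have := testSize_nonneg N Φ; positivity
  rw [tendsto_iff_edist_tendsto_0]
  have hlim : Tendsto (fun k => ENNReal.ofReal A * K * hardyNorm N p (f k - g)) atTop (𝓝 0) := by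
    have := ENNReal.Tendsto.const_mul (a := ENNReal.ofReal A * K) h
      (Or.inr (ENNReal.mul_ne_top ENNReal.ofReal_ne_top hK))
    simpa using this
  refine tendsto_of_tendsto_of_tendsto_of_le_of_le tendsto_const_nhds hlim
    (fun _ => zero_le) fun k => ?_
  dsimp only
  rw [edist_eq_enorm_sub]
  exact hle (f k - g) Φ A hA (by simp [A])

/-- A linear functional on the Schwartz space that is dominated by the test size is continuous. -/
lemma continuous_of_norm_le_testSize (N : ℕ) (L : 𝓢(Rn n, ℂ) →ₗ[ℂ] ℂ) (C : ℝ)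
    (hL : ∀ Φ, ‖L Φ‖ ≤ C * testSize N Φ) : Continuous L := by
  refine continuous_of_continuousAt_zero L ?_
  rw [ContinuousAt, map_zero]
  refine squeeze_zero_norm hL ?_
  have : Continuous fun Φ : 𝓢(Rn n, ℂ) => C * testSize N Φ :=
    continuous_const.mul (continuous_testSize N)
  simpa [testSize_zero] using this.tendsto 0

/-- A sequence that is Cauchy in the Hardy quasi-norm converges pointwise to a tempered
distribution. -/
lemma exists_tendsto_of_cauchy {p : Rn n → ℝ} {p₀ : ℝ} (h₀ : IsMaxExponent p p₀) (N : ℕ)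
    {f : ℕ → 𝓢'(Rn n, ℂ)}
    (hf : ∀ ε : ℝ≥0∞, 0 < ε → ∃ K, ∀ j ≥ K, ∀ k ≥ K, hardyNorm N p (f j - f k) < ε) :
    ∃ g : 𝓢'(Rn n, ℂ), ∀ Φ, Tendsto (fun j => f j Φ) atTop (𝓝 (g Φ)) := by
  obtain ⟨K, hK, hle⟩ := exists_enorm_apply_le_mul_hardyNorm h₀ N
  have hcauchy : ∀ Φ, CauchySeq fun j => f j Φ := by
    intro Φ
    set A := testSize N Φ + 1
    have hA : 0 < A := by have := testSize_nonneg N Φ; positivity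
    have hAK : ENNReal.ofReal A * K ≠ ∞ := ENNReal.mul_ne_top ENNReal.ofReal_ne_top hK
    refine EMetric.cauchySeq_iff.2 fun ε hε => ?_
    obtain ⟨δ, hδ, hδε⟩ := ENNReal.exists_pos_mul_lt hAK hε.ne'
    obtain ⟨J, hJ⟩ := hf δ hδ
    refine ⟨J, fun j hj k hk => ?_⟩
    rw [edist_eq_enorm_sub]
    refine (hle (f j - f k) Φ A hA (by simp [A])).trans_lt (lt_of_le_of_lt ?_ hδε)
    rw [mul_comm]
    gcongr
    exact (hJ j hj k hk).le
  choose G hG using fun Φ => cauchySeq_tendsto_of_complete (hcauchy Φ)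
  let L : 𝓢(Rn n, ℂ) →ₗ[ℂ] ℂ :=
    { toFun := G
      map_add' := fun Φ Ψ => tendsto_nhds_unique (hG (Φ + Ψ)) (by
        simpa only [map_add] using (hG Φ).add (hG Ψ))
      map_smul' := fun c Φ => tendsto_nhds_unique (hG (c • Φ)) (by
        simpa only [map_smul, RingHom.id_apply] using (hG Φ).const_smul c) }
  obtain ⟨J, hJ⟩ := hf 1 one_pos
  have hbound : ∀ Φ, ‖(L - (f J : 𝓢(Rn n, ℂ) →ₗ[ℂ] ℂ)) Φ‖ ≤ K.toReal * testSize N Φ := by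
    intro Φ
    have hlim : Tendsto (fun j => ‖f j Φ - f J Φ‖) atTop (𝓝 ‖G Φ - f J Φ‖) :=
      ((hG Φ).sub_const _).norm
    refine le_of_tendsto hlim ((eventually_ge_atTop J).mono fun j hj => ?_)
    -- Continuity at zero needs the bound with `testSize` itself, which may vanish; `A` is taken
    -- strictly larger and then decreased to it.
    have hA : ∀ A > testSize N Φ, ‖f j Φ - f J Φ‖ ≤ K.toReal * A := by
      intro A hA
      have hA0 : 0 < A := (testSize_nonneg N Φ).trans_lt hA
      have h1 : ‖f j Φ - f J Φ‖ₑ ≤ ENNReal.ofReal (K.toReal * A) := by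
        rw [ENNReal.ofReal_mul ENNReal.toReal_nonneg, ENNReal.ofReal_toReal hK, mul_comm]
        exact (hle (f j - f J) Φ A hA0 hA.le).trans
          (mul_le_of_le_one_right' (hJ j hj J le_rfl).le)
      rw [← ofReal_norm] at h1
      exact (ENNReal.ofReal_le_ofReal_iff (by positivity)).1 h1
    have hcont : Tendsto (fun A : ℝ => K.toReal * A) (𝓝[>] testSize N Φ)
        (𝓝 (K.toReal * testSize N Φ)) :=
      ((continuous_const.mul continuous_id).tendsto _).mono_left nhdsWithin_le_nhds
    exact ge_of_tendsto hcont (eventually_mem_nhdsWithin.mono hA)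
  have hL : Continuous L := by
    have := (continuous_of_norm_le_testSize N _ _ hbound).add (f J).continuous
    refine this.congr fun Φ => ?_
    exact sub_add_cancel (L Φ) (f J Φ)
  exact ⟨(⟨L, hL⟩ : 𝓢(Rn n, ℂ) →L[ℂ] ℂ), hG⟩

/-- The Hardy space is complete. -/
lemma exists_tendsto_hardyNorm_of_cauchy {p : Rn n → ℝ} (hp : MemP0 p) {p₀ : ℝ}
    (h₀ : IsMaxExponent p p₀) (N : ℕ) {f : ℕ → 𝓢'(Rn n, ℂ)} (hfH : ∀ k, f k ∈ hardySpace N p)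
    (hf : ∀ ε : ℝ≥0∞, 0 < ε → ∃ K, ∀ j ≥ K, ∀ k ≥ K, hardyNorm N p (f j - f k) < ε) :
    ∃ g ∈ hardySpace N p, Tendsto (fun k => hardyNorm N p (f k - g)) atTop (𝓝 0) := by
  obtain ⟨g, hg⟩ := exists_tendsto_of_cauchy h₀ N hf
  have hle : ∀ ε : ℝ, 0 < ε → ∃ J, ∀ k ≥ J, hardyNorm N p (f k - g) ≤ ENNReal.ofReal ε := by
    intro ε hε
    obtain ⟨J, hJ⟩ := hf (ENNReal.ofReal ε) (by simpa using hε)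
    -- Fatou is applied with `k` fixed, to `f k - f j → f k - g` as `j → ∞`.
    refine ⟨J, fun k hk => luxNorm_le_of_le_liminf hp (G := fun j => grandMax N (f k - f j))
      (fun j => measurable_grandMax N _) ?_ hε ((eventually_ge_atTop J).mono (hJ k hk))⟩
    exact grandMax_le_liminf N fun Φ => (hg Φ).const_sub (f k Φ)
  refine ⟨g, ?_, ?_⟩
  · obtain ⟨J, hJ⟩ := hle 1 one_pos
    refine luxNorm_lt_top_of_le_add hp h₀ (measurable_grandMax N (f J)) (fun x => ?_) (hfH J)
      ((hJ J le_rfl).trans_lt ENNReal.ofReal_lt_top)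
    -- Here `g = f J - (f J - g)`.
    simpa only [sub_sub_cancel] using grandMax_sub_le N (f J) (f J - g) x
  · refine ENNReal.tendsto_nhds_zero.2 fun ε hε => ?_
    obtain ⟨δ, hδ, hδε⟩ := ENNReal.lt_iff_exists_nnreal_btwn.1 hε
    obtain ⟨J, hJ⟩ := hle δ (by exact_mod_cast hδ)
    filter_upwards [eventually_ge_atTop J] with k hk
    exact (hJ k hk).trans (by simpa using hδε.le)

end VariableHardy

end

theorem proposition4p1 {n : ℕ} (p : VariableHardy.Rn n → ℝ) (hp : VariableHardy.MemMP0 p)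
    (p₀ : ℝ) (hp₀ : VariableHardy.IsMaxExponent p p₀)
    (N : ℕ) (hN : (n : ℝ) / p₀ + n + 1 < N) :
    -- Cauchy sequences in the Hardy space converge in the Hardy space
    (∀ f : ℕ → 𝓢'(VariableHardy.Rn n, ℂ), (∀ k, f k ∈ VariableHardy.hardySpace N p) →
      (∀ ε : ℝ≥0∞, 0 < ε → ∃ K, ∀ j ≥ K, ∀ k ≥ K,
        VariableHardy.hardyNorm N p (f j - f k) < ε) →
      ∃ g ∈ VariableHardy.hardySpace N p,
        Tendsto (fun k => VariableHardy.hardyNorm N p (f k - g)) atTop (𝓝 0)) ∧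
    -- convergence in the Hardy space implies convergence of tempered distributions
    (∀ (f : ℕ → 𝓢'(VariableHardy.Rn n, ℂ)) (g : 𝓢'(VariableHardy.Rn n, ℂ)),
      (∀ k, f k ∈ VariableHardy.hardySpace N p) → g ∈ VariableHardy.hardySpace N p →
      Tendsto (fun k => VariableHardy.hardyNorm N p (f k - g)) atTop (𝓝 0) →
      Tendsto f atTop (𝓝 g)) := by
  exact ⟨fun f hfH hf =>
      VariableHardy.exists_tendsto_hardyNorm_of_cauchy hp.1 hp₀ N hfH hf,
    fun f g _ _ h => VariableHardy.tendsto_of_tendsto_hardyNorm hp₀ N h⟩
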